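/- There is a compact smooth manifold $M$ (Hausdorff, without boundary, of dimension 5) with the following property. For every $r\in\{1,2,\dots,\infty\}$ there is a set $\mathcal A$ of $C^r$ vector fields on $M$ such that: (1) every $Y\in\mathcal A$ is topologically chaotic but statistically trivial, that is, the flow $\phi=(\phi_t)_{t\in\mathbb R}$ induced by $Y$ has a dense orbit $\{\phi_t(x):t\in\mathbb R\}$, it has a unique fixed point $p$, and the Dirac mass $\delta_p$ is its only ergodic measure. Here an ergodic measure is a Borel probability measure that is invariant under all $\phi_t$ and gives every $\phi$-invariant Borel set measure $0$ or $1$. (2) $\mathcal A$ is (nonempty and) connected in the $C^r$ topology, and it is infinite-dimensional: its linear span in the space of $C^r$ vector fields is infinite-dimensional, and for every $n\in\mathbb N$ it contains a subset homeomorphic to the cube $[0,1]^n$. For finite $r$ the $C^r$ topology is that of uniform convergence, on compact subsets of charts, of the local expressions of the fields together with their derivatives of order at most $r$; for $r=\infty$ all derivatives are taken. -/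

import Mathlib

open scoped Manifold ContDiff
open MeasureTheory

noncomputable section

namespace ChaosTriviality

/-! ### Continuous flows -/

section Flows

variable {M : Type*} [TopologicalSpace M]

/-- Topological transitivity: some orbit `{φ t x | t ∈ ℝ}` is dense. -/
def IsTransitive (φ : Flow ℝ M) : Prop :=
  ∃ x : M, Dense (φ.orbit x)

/-- `x` is a fixed point of the flow. -/
def IsFixedPoint (φ : Flow ℝ M) (x : M) : Prop :=
  ∀ t : ℝ, φ t x = x

variable [MeasurableSpace M]

/-- `μ` is a `φ`-invariant and `φ`-ergodic probability measure: `μ` is preserved by every `φ t`,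
and every `φ`-invariant measurable set has measure `0` or `1`. -/
structure IsErgodicMeasure (φ : Flow ℝ M) (μ : Measure M) : Prop where
  isProbabilityMeasure : IsProbabilityMeasure μ
  invariant : ∀ t : ℝ, MeasurePreserving (φ t) μ μ
  ergodic : ∀ B : Set M, MeasurableSet B → (∀ t : ℝ, φ t ⁻¹' B = B) → μ B = 0 ∨ μ B = 1

/-- The flow is topologically chaotic but statistically trivial: it is transitive, it has a single
fixed point `p`, and the Dirac mass at `p` is its only ergodic probability measure. -/
def IsChaoticTrivialFlow (φ : Flow ℝ M) : Prop :=
  IsTransitive φ ∧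
    ∃ p : M, (∀ x : M, IsFixedPoint φ x ↔ x = p) ∧
      ∀ μ : Measure M, IsErgodicMeasure φ μ ↔ μ = Measure.dirac p

end Flows

/-! ### `C^r` vector fields on a manifold without boundary, modelled on `E` -/

section VectorFields

variable {E : Type*} [NormedAddCommGroup E] [NormedSpace ℝ E]
  {M : Type*} [TopologicalSpace M] [ChartedSpace E M] [IsManifold 𝓘(ℝ, E) ∞ M]

variable (E M) in
/-- The real vector space of `C^r` vector fields on `M`, that is, `C^r` sections of the tangent
bundle. -/
abbrev VectorFields (r : ℕ∞) : Type _ :=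
  ContMDiffSection 𝓘(ℝ, E) E (r : WithTop ℕ∞) (TangentSpace 𝓘(ℝ, E) : M → Type _)

/-- The expression of a vector field in the preferred chart `ψ` at `x₀`: the map
`y ↦ Dψ (Y (ψ⁻¹ y))`, meaningful for `y` in the (open) target of `ψ`. -/
def localExpression (x₀ : M) {r : ℕ∞} (Y : VectorFields E M r) (y : E) : E :=
  mfderiv 𝓘(ℝ, E) 𝓘(ℝ, E) (chartAt E x₀) ((chartAt E x₀).symm y) (Y ((chartAt E x₀).symm y))

/-- The `C^r` topology: uniform convergence, on the compact subsets of the preferred charts (which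
cover `M`), of all derivatives of finite order `k ≤ r` of the expressions in these charts. -/
instance vectorFieldsTopology (r : ℕ∞) : TopologicalSpace (VectorFields E M r) :=
  ⨅ (x₀ : M) (k : ℕ) (_ : (k : ℕ∞) ≤ r),
    TopologicalSpace.induced
      (fun Y : VectorFields E M r =>
        UniformOnFun.ofFun {K : Set E | IsCompact K ∧ K ⊆ (chartAt E x₀).target}
          (iteratedFDeriv ℝ k (localExpression x₀ Y)))
      inferInstance

/-- The flow `φ` is induced by `Y`: all its trajectories are integral curves of `Y`. -/
def Induces {r : ℕ∞} (Y : VectorFields E M r) (φ : Flow ℝ M) : Prop :=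
  ∀ x : M, IsMIntegralCurve (I := 𝓘(ℝ, E)) (fun t : ℝ => φ t x) (fun y : M => Y y)

variable (E M) in
/-- The set of `C^r` vector fields whose induced flow is topologically chaotic but statistically
trivial. -/
def chaoticTrivialFields [MeasurableSpace M] (r : ℕ∞) : Set (VectorFields E M r) :=
  {Y | ∃ φ : Flow ℝ M, Induces Y φ ∧ IsChaoticTrivialFlow φ}

end VectorFields

/-- A subset of a real vector space with a topology is infinite-dimensional here in both the linear
and the topological sense: it contains infinitely many linearly independent vectors (its span is
not finite-dimensional), and it contains topological cubes of every finite dimension. -/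
def IsInfiniteDimensional {V : Type*} [AddCommGroup V] [Module ℝ V] [TopologicalSpace V]
    (A : Set V) : Prop :=
  ¬ FiniteDimensional ℝ (Submodule.span ℝ A) ∧
    ∀ n : ℕ, ∃ S ⊆ A, Nonempty (S ≃ₜ (Fin n → unitInterval))

end ChaosTriviality

end

/-! On the five-dimensional torus take a constant field `v` with rationally independent coordinates,
and slow it down to `f • v`, where `f ≥ 0` is smooth and vanishes only at the origin, to order at
least dimension plus one.

Chaos: the slowed flow is a time change of the linear flow. An orbit lying on a line that misses the
origin covers that whole line (`exists_flow_eq_add_smul`), which is dense by Kronecker's theorem.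

Triviality: let `μ` be an invariant probability measure. Differentiating the constant function `t ↦
∫ mFourier k (φ t x) ∂μ` at `t = 0` shows that `f μ` has vanishing Fourier coefficients for `k ≠ 0`,
so `f μ` is `c` times Lebesgue measure (`measure_eq_smul_volume`). On a cube of side `2ε` about the
origin this reads `c (2ε)^n ≤ C ε^(n+1)`. Hence `c = 0`, and `μ` lives on the zero set of `f`, which
is the origin (`IsFlatAtZero.eq_dirac`).

Size: the admissible `f` form a convex set, so the fields are joined by segments. Multiplying one
such `f` by positive polynomials in a trigonometric function gives infinitely many independent
directions and cubes of every dimension. -/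

noncomputable section

open Set Filter Topology Bundle

/-! ### The torus as a smooth manifold covered by Euclidean space. -/

section

namespace UnitAddTorus

variable {ι : Type*}

/-- The covering map from Euclidean space to the torus. -/
def proj (y : EuclideanSpace ℝ ι) : UnitAddTorus ι := fun i => (y i : UnitAddCircle)

@[simp] lemma proj_apply (y : EuclideanSpace ℝ ι) (i : ι) : proj y i = (y i : UnitAddCircle) := rfl

@[simp] lemma proj_zero : proj (0 : EuclideanSpace ℝ ι) = 0 := by ext i; simp

lemma proj_add (y z : EuclideanSpace ℝ ι) : proj (y + z) = proj y + proj z := by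
  ext i; simp

lemma proj_sub (y z : EuclideanSpace ℝ ι) : proj (y - z) = proj y - proj z := by
  ext i; simp

lemma proj_eq_zero_iff {y : EuclideanSpace ℝ ι} : proj y = 0 ↔ ∀ i, ∃ n : ℤ, (n : ℝ) = y i := by
  simp only [funext_iff, proj_apply, Pi.zero_apply, AddCircle.coe_eq_zero_iff, zsmul_eq_mul, mul_one]

lemma continuous_proj : Continuous (proj : EuclideanSpace ℝ ι → UnitAddTorus ι) := by
  refine continuous_pi fun i => ?_
  exact (AddCircle.continuous_mk' 1).comp (by fun_prop)

/-- A representative in Euclidean space of a point of the torus. -/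
def lift (x : UnitAddTorus ι) : EuclideanSpace ℝ ι :=
  WithLp.toLp 2 fun i => (AddCircle.equivIco 1 0 (x i) : ℝ)

@[simp] lemma proj_lift (x : UnitAddTorus ι) : proj (lift x) = x := by
  ext i
  exact (AddCircle.equivIco 1 0).symm_apply_apply (x i)

lemma proj_surjective : Function.Surjective (proj : EuclideanSpace ℝ ι → UnitAddTorus ι) :=
  fun x => ⟨lift x, proj_lift x⟩

variable [Fintype ι]

/-- The covering map, restricted to a unit box. -/
def boxChart (a : ι → ℝ) : OpenPartialHomeomorph (EuclideanSpace ℝ ι) (UnitAddTorus ι) :=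
  (EuclideanSpace.equiv ι ℝ).toHomeomorph.transOpenPartialHomeomorph
    (OpenPartialHomeomorph.pi fun i => AddCircle.openPartialHomeomorphCoe 1 (a i))

lemma coe_boxChart (a : ι → ℝ) : ⇑(boxChart a) = proj := rfl

lemma mem_boxChart_source {a : ι → ℝ} {y : EuclideanSpace ℝ ι} :
    y ∈ (boxChart a).source ↔ ∀ i, y i ∈ Ioo (a i) (a i + 1) := by
  simp [boxChart, OpenPartialHomeomorph.pi]

instance : ChartedSpace (EuclideanSpace ℝ ι) (UnitAddTorus ι) where
  atlas := range fun a : ι → ℝ => (boxChart a).symm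
  -- The shift by one half centres the open unit box at `lift x`.
  chartAt x := (boxChart fun i => lift x i - 1 / 2).symm
  mem_chart_source x := by
    have : lift x ∈ (boxChart fun i => lift x i - 1 / 2).source := by
      rw [mem_boxChart_source]
      intro i
      constructor <;> linarith
    simpa [coe_boxChart] using (boxChart fun i => lift x i - 1 / 2).map_source this
  chart_mem_atlas x := ⟨_, rfl⟩

local notation "𝔼" => EuclideanSpace ℝ ι

lemma proj_chartAt {x z : UnitAddTorus ι} (hz : z ∈ (chartAt 𝔼 x).source) :
    proj (chartAt 𝔼 x z) = z :=
  (chartAt 𝔼 x).left_inv hz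

/-- Two lifts of a point differ by a lattice vector, locally constant inside an open box. All
transition maps are thus local translations, with derivative the identity. -/
lemma boxChart_symm_proj_eventuallyEq {a : ι → ℝ} {y : 𝔼} (hy : proj y ∈ (boxChart a).target) :
    (fun z => (boxChart a).symm (proj z)) =ᶠ[𝓝 y]
      fun z => z + ((boxChart a).symm (proj y) - y) := by
  set c := (boxChart a).symm (proj y) - y with hc
  have h1 : y + c ∈ (boxChart a).source := by
    rw [hc, add_sub_cancel]
    exact (boxChart a).map_target hy
  have h0 : proj c = 0 := by
    rw [hc, proj_sub, sub_eq_zero]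
    exact (boxChart a).right_inv hy
  have h2 : ∀ᶠ z in 𝓝 y, z + c ∈ (boxChart a).source :=
    (continuous_add_const c).continuousAt.eventually ((boxChart a).open_source.mem_nhds h1)
  filter_upwards [h2] with z hz
  have h3 : proj z = proj (z + c) := by rw [proj_add, h0, add_zero]
  rw [h3]
  exact (boxChart a).left_inv hz

lemma chartAt_proj_eventuallyEq {x : UnitAddTorus ι} {y : 𝔼}
    (hy : proj y ∈ (chartAt 𝔼 x).source) :
    (fun z => chartAt 𝔼 x (proj z)) =ᶠ[𝓝 y] fun z => z + (chartAt 𝔼 x (proj y) - y) :=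
  boxChart_symm_proj_eventuallyEq hy

instance : IsManifold 𝓘(ℝ, EuclideanSpace ℝ ι) ∞ (UnitAddTorus ι) := by
  refine isManifold_of_contDiffOn _ _ _ ?_
  rintro _ _ ⟨a, rfl⟩ ⟨b, rfl⟩ y hy
  simp only [mfld_simps, coe_boxChart] at hy ⊢
  refine ContDiffAt.contDiffWithinAt ?_
  refine ContDiffAt.congr_of_eventuallyEq ?_ (boxChart_symm_proj_eventuallyEq hy.2)
  fun_prop

lemma hasFDerivAt_chartAt_proj {x : UnitAddTorus ι} {y : 𝔼}
    (hy : proj y ∈ (chartAt 𝔼 x).source) :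
    HasFDerivAt (fun z => chartAt 𝔼 x (proj z)) (ContinuousLinearMap.id ℝ 𝔼) y :=
  ((hasFDerivAt_id y).add_const _).congr_of_eventuallyEq (chartAt_proj_eventuallyEq hy)

/-- Each tangent space is identified with `𝔼` through the preferred chart, and this chart inverts
`proj` up to a translation. Vectors on the torus and on the cover can therefore be compared
directly. -/
lemma hasMFDerivAt_proj (y : 𝔼) :
    HasMFDerivAt 𝓘(ℝ, 𝔼) 𝓘(ℝ, 𝔼) (proj : 𝔼 → UnitAddTorus ι) y
      (ContinuousLinearMap.id ℝ 𝔼) := by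
  refine ⟨continuous_proj.continuousAt, ?_⟩
  simp only [mfld_simps]
  exact (hasFDerivAt_chartAt_proj (mem_chart_source 𝔼 (proj y))).hasFDerivWithinAt

lemma hasMFDerivAt_chartAt {x z : UnitAddTorus ι} (hz : z ∈ (chartAt 𝔼 x).source) :
    HasMFDerivAt 𝓘(ℝ, 𝔼) 𝓘(ℝ, 𝔼) (chartAt 𝔼 x) z (ContinuousLinearMap.id ℝ 𝔼) := by
  refine ⟨(chartAt 𝔼 x).continuousAt hz, ?_⟩
  simp only [mfld_simps]
  refine (hasFDerivAt_chartAt_proj ?_).hasFDerivWithinAt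
  rwa [proj_chartAt (mem_chart_source 𝔼 z)]

/-- A constant vector field on the torus is smooth. -/
lemma contMDiff_const_section (v : 𝔼) {n : WithTop ℕ∞} :
    ContMDiff 𝓘(ℝ, 𝔼) (𝓘(ℝ, 𝔼).prod 𝓘(ℝ, 𝔼)) n
      (fun x : UnitAddTorus ι =>
        TotalSpace.mk' 𝔼 (E := (TangentSpace 𝓘(ℝ, 𝔼) : UnitAddTorus ι → Type _)) x v) := by
  intro x
  refine (contMDiffAt_section (E := (TangentSpace 𝓘(ℝ, 𝔼) : UnitAddTorus ι → Type _))
    (s := fun _ => v) x).2 ?_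
  refine (contMDiffAt_const (c := v)).congr_of_eventuallyEq ?_
  filter_upwards [(chartAt 𝔼 x).open_source.mem_nhds (mem_chart_source 𝔼 x)] with z hz
  rw [TangentBundle.trivializationAt_apply]
  simp only [mfld_simps, fderivWithin_univ]
  have h := hasFDerivAt_chartAt_proj (x := x) (y := chartAt 𝔼 z z)
    (by rwa [proj_chartAt (mem_chart_source 𝔼 z)])
  exact DFunLike.congr_fun h.fderiv v

lemma contMDiff_of_contDiff_comp_proj {F : Type*} [NormedAddCommGroup F] [NormedSpace ℝ F]
    {f : UnitAddTorus ι → F} {n : WithTop ℕ∞} (hn : n ≤ ∞)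
    (hf : ContDiff ℝ n (fun y => f (proj y))) :
    ContMDiff 𝓘(ℝ, 𝔼) 𝓘(ℝ, F) n f := by
  intro x
  have : IsManifold 𝓘(ℝ, 𝔼) n (UnitAddTorus ι) := .of_le hn
  have h1 : ContMDiffAt 𝓘(ℝ, 𝔼) 𝓘(ℝ, 𝔼) n (chartAt 𝔼 x) x :=
    contMDiffOn_chart.contMDiffAt ((chartAt 𝔼 x).open_source.mem_nhds (mem_chart_source 𝔼 x))
  refine (hf.contMDiff.contMDiffAt.comp x h1).congr_of_eventuallyEq ?_
  filter_upwards [(chartAt 𝔼 x).open_source.mem_nhds (mem_chart_source 𝔼 x)] with z hz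
  simp [proj_chartAt hz]

end UnitAddTorus

end

/-! ### Global flows of bounded Lipschitz fields and their descent to the torus. -/

section

section GlobalFlow

open Metric
open scoped NNReal

variable {E : Type*} [NormedAddCommGroup E] [NormedSpace ℝ E] [CompleteSpace E]
  {F : E → E} {K L : ℝ≥0}

/-- The speed bound `L` keeps a trajectory starting within distance `1` of `x₀` inside the ball of
radius `L T + 1` up to time `T`, so Picard–Lindelöf applies for every `T`. -/
lemma LipschitzWith.exists_local_flow (hF : LipschitzWith K F) (hL : ∀ x, ‖F x‖ ≤ L)
    (x₀ : E) {T : ℝ} (hT : 0 < T) :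
    ∃ α : E × ℝ → E, (∀ x ∈ closedBall x₀ 1, α (x, 0) = x ∧
      ∀ t ∈ Ioo (-T) T, HasDerivAt (fun s => α (x, s)) (F (α (x, t))) t) ∧
      ContinuousOn α (closedBall x₀ 1 ×ˢ Icc (-T) T) := by
  have h : IsPicardLindelof (fun _ => F) (tmin := -T) (tmax := T)
      ⟨0, by constructor <;> linarith⟩ x₀ (L * T.toNNReal + 1) 1 L K :=
    { lipschitzOnWith := fun _ _ => hF.lipschitzOnWith
      continuousOn := fun _ _ => continuousOn_const
      norm_le := fun _ _ x _ => hL x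
      mul_max_le := by simp [hT.le] }
  obtain ⟨α, h1, h2⟩ := h.exists_forall_mem_closedBall_eq_hasDerivWithinAt_continuousOn
  refine ⟨α, fun x hx => ⟨(h1 x hx).1, fun t ht => ?_⟩, h2⟩
  exact ((h1 x hx).2 t (Ioo_subset_Icc_self ht)).hasDerivAt (Icc_mem_nhds ht.1 ht.2)

/-- A bounded Lipschitz vector field on a Banach space induces a global flow. -/
theorem LipschitzWith.exists_flow (hF : LipschitzWith K F) (hL : ∀ x, ‖F x‖ ≤ L) :
    ∃ φ : Flow ℝ E, ∀ x t, HasDerivAt (fun s => φ s x) (F (φ t x)) t := by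
  choose α hα hαc using fun (p : E × ℝ) =>
    hF.exists_local_flow hL p.1 (T := |p.2| + 1) (by positivity)
  -- The local flows are indexed by centre and time horizon. By uniqueness they agree on overlaps,
  -- so evaluating each at its own index gives a global flow.
  have key : ∀ (x₀ x : E) (T t : ℝ), x ∈ closedBall x₀ 1 → |t| < |T| + 1 →
      α (x, t) (x, t) = α (x₀, T) (x, t) := by
    intro x₀ x T t hx ht
    have hb : ∀ s, |s| < min (|t| + 1) (|T| + 1) → |s| < |t| + 1 ∧ |s| < |T| + 1 :=
      fun s hs => lt_min_iff.1 hs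
    have hpos : 0 < min (|t| + 1) (|T| + 1) := lt_min (by positivity) (by positivity)
    have h := ODE_solution_unique_of_mem_Ioo (v := fun _ => F) (s := fun _ => univ) (K := K)
      (a := -min (|t| + 1) (|T| + 1)) (b := min (|t| + 1) (|T| + 1)) (t₀ := 0)
      (f := fun s => α (x, t) (x, s)) (g := fun s => α (x₀, T) (x, s))
      (fun _ _ => hF.lipschitzOnWith) ⟨by linarith, hpos⟩
      (fun s hs => ⟨((hα (x, t) x (mem_closedBall_self zero_le_one)).2 s
        (abs_lt.1 (hb s (abs_lt.2 hs)).1)), mem_univ _⟩)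
      (fun s hs => ⟨((hα (x₀, T) x hx).2 s (abs_lt.1 (hb s (abs_lt.2 hs)).2)), mem_univ _⟩)
      (((hα (x, t) x (mem_closedBall_self zero_le_one)).1).trans ((hα (x₀, T) x hx).1).symm)
    exact h (abs_lt.1 (lt_min (by linarith) ht))
  have h0 : ∀ x, α (x, 0) (x, 0) = x := fun x =>
    (hα (x, 0) x (mem_closedBall_self zero_le_one)).1
  have hd : ∀ x t, HasDerivAt (fun s => α (x, s) (x, s)) (F (α (x, t) (x, t))) t := by
    intro x t
    refine ((hα (x, t) x (mem_closedBall_self zero_le_one)).2 t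
      (abs_lt.1 (by simp))).congr_of_eventuallyEq ?_
    have : ∀ᶠ s in 𝓝 t, |s| < |t| + 1 :=
      continuous_abs.continuousAt.eventually_lt continuousAt_const (by simp)
    filter_upwards [this] with s hs
    exact key x x t s (mem_closedBall_self zero_le_one) hs
  refine ⟨⟨fun t x => α (x, t) (x, t), ?_, ?_, h0⟩, hd⟩
  · rw [continuous_iff_continuousAt]
    rintro ⟨t, x⟩
    have h1 : ContinuousAt (α (x, t)) (x, t) := by
      refine (hαc (x, t)).continuousAt (prod_mem_nhds (closedBall_mem_nhds _ one_pos) ?_)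
      exact Icc_mem_nhds (abs_lt.1 (by simp)).1 (abs_lt.1 (by simp)).2
    have h2 : ContinuousAt (fun p : ℝ × E => α (x, t) (p.2, p.1)) (t, x) :=
      ContinuousAt.comp (f := fun p : ℝ × E => (p.2, p.1)) h1 (by fun_prop)
    refine h2.congr ?_
    have h3 : ∀ᶠ p : ℝ × E in 𝓝 (t, x), |p.1| < |t| + 1 :=
      (continuous_abs.comp continuous_fst).continuousAt.eventually_lt continuousAt_const (by simp)
    have h4 : ∀ᶠ p : ℝ × E in 𝓝 (t, x), p.2 ∈ closedBall x 1 :=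
      continuousAt_snd.eventually (closedBall_mem_nhds _ one_pos)
    filter_upwards [h3, h4] with p hp hp'
    exact (key x p.2 t p.1 hp' hp).symm
  · intro t₁ t₂ x
    have h := ODE_solution_unique_univ (v := fun _ => F) (s := fun _ => univ) (K := K)
      (f := fun t => α (x, t + t₂) (x, t + t₂))
      (g := fun t => α (α (x, t₂) (x, t₂), t) (α (x, t₂) (x, t₂), t)) (t₀ := 0)
      (fun _ => hF.lipschitzOnWith)
      (fun t => ⟨(hd x (t + t₂)).comp_add_const t t₂, mem_univ _⟩)
      (fun t => ⟨hd _ t, mem_univ _⟩) (by simp [h0])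
    exact congrFun h t₁

end GlobalFlow

namespace UnitAddTorus

variable {ι : Type*}

lemma proj_add_eq_of_proj_eq_zero {c : EuclideanSpace ℝ ι} (hc : proj c = 0)
    (y : EuclideanSpace ℝ ι) : proj (y + c) = proj y := by
  rw [proj_add, hc, add_zero]

lemma exists_add_of_proj_eq {y z : EuclideanSpace ℝ ι} (h : proj y = proj z) :
    ∃ c, proj c = 0 ∧ z = y + c :=
  ⟨z - y, by rw [proj_sub, h, sub_self], by abel⟩

lemma isOpenQuotientMap_proj :
    IsOpenQuotientMap (proj : EuclideanSpace ℝ ι → UnitAddTorus ι) := by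
  refine ⟨proj_surjective, continuous_proj, ?_⟩
  have h : IsOpenMap (Pi.map fun (_ : ι) (t : ℝ) => (t : UnitAddCircle)) :=
    IsOpenMap.piMap (fun _ => QuotientAddGroup.isOpenMap_coe)
      (Eventually.of_forall fun _ => QuotientAddGroup.mk_surjective)
  exact h.comp (EuclideanSpace.equiv ι ℝ).toHomeomorph.isOpenMap

lemma continuous_comp_proj_iff {X : Type*} [TopologicalSpace X] {f : UnitAddTorus ι → X} :
    Continuous (fun y => f (proj y)) ↔ Continuous f :=
  isOpenQuotientMap_proj.isQuotientMap.continuous_iff.symm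

variable [Fintype ι]

local notation "𝔼" => EuclideanSpace ℝ ι

/-- The derivative of the periodic lift is periodic, so it descends to the compact torus and is
bounded. -/
lemma exists_lipschitzWith_comp_proj {f : UnitAddTorus ι → ℝ}
    (hf : ContDiff ℝ 1 (fun y => f (proj y))) :
    ∃ K, LipschitzWith K (fun y => f (proj y)) := by
  set D := fderiv ℝ (fun y => f (proj y)) with hD
  have hper : ∀ y, D (lift (proj y)) = D y := by
    intro y
    obtain ⟨c, hc, h⟩ := exists_add_of_proj_eq (proj_lift (proj y)).symm
    rw [h, hD, ← fderiv_comp_add_right]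
    simp only [proj_add_eq_of_proj_eq_zero hc]
  have hcont : Continuous fun x => D (lift x) := by
    rw [← continuous_comp_proj_iff]
    simpa only [hper] using hf.continuous_fderiv one_ne_zero
  obtain ⟨C, hC⟩ := (isCompact_range hcont).isBounded.exists_norm_le
  refine ⟨C.toNNReal, lipschitzWith_of_nnnorm_fderiv_le (hf.differentiable one_ne_zero) fun y => ?_⟩
  rw [← NNReal.coe_le_coe, coe_nnnorm]
  refine le_trans ?_ (Real.le_coe_toNNReal C)
  change ‖D y‖ ≤ C
  rw [← hper]
  exact hC _ ⟨_, rfl⟩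

/-- A flow on the torus and its lift to Euclidean space, for a multiple of a constant vector
field. -/
theorem exists_flow {f : UnitAddTorus ι → ℝ} (v : 𝔼)
    (hf : ContDiff ℝ 1 (fun y => f (proj y))) :
    ∃ φ : Flow ℝ (UnitAddTorus ι), ∃ Φ : Flow ℝ 𝔼, (∀ t y, φ t (proj y) = proj (Φ t y)) ∧
      ∀ y t, HasDerivAt (fun s => Φ s y) (f (proj (Φ t y)) • v) t := by
  obtain ⟨K, hK⟩ := exists_lipschitzWith_comp_proj hf
  have hK' : LipschitzWith (‖ContinuousLinearMap.toSpanSingleton ℝ v‖₊ * K)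
      fun y => f (proj y) • v :=
    (ContinuousLinearMap.toSpanSingleton ℝ v).lipschitz.comp hK
  have hcont : Continuous f := continuous_comp_proj_iff.1 hf.continuous
  obtain ⟨C, hC⟩ := (isCompact_range hcont).isBounded.exists_norm_le
  obtain ⟨Φ, hΦ⟩ := hK'.exists_flow (L := (C * ‖v‖).toNNReal) fun y => by
    refine le_trans ?_ (Real.le_coe_toNNReal _)
    rw [norm_smul]
    gcongr
    exact hC _ ⟨_, rfl⟩
  -- By uniqueness of solutions, the lifted flow commutes with lattice translations and so descends.
  have hper : ∀ t y c, proj c = 0 → Φ t (y + c) = Φ t y + c := by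
    intro t y c hc
    have h := ODE_solution_unique_univ (v := fun _ y => f (proj y) • v) (s := fun _ => univ)
      (f := fun t => Φ t (y + c)) (g := fun t => Φ t y + c) (t₀ := 0)
      (fun _ => hK'.lipschitzOnWith) (fun t => ⟨hΦ _ t, mem_univ _⟩)
      (fun t => ⟨by
        simpa only [proj_add_eq_of_proj_eq_zero hc] using (hΦ y t).add_const c, mem_univ _⟩)
      (by simp)
    exact congrFun h t
  have hsemi : ∀ t y, proj (Φ t (lift (proj y))) = proj (Φ t y) := by
    intro t y
    obtain ⟨c, hc, h⟩ := exists_add_of_proj_eq (proj_lift (proj y)).symm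
    rw [h, hper t y c hc, proj_add_eq_of_proj_eq_zero hc]
  refine ⟨⟨fun t x => proj (Φ t (lift x)), ?_, ?_, ?_⟩, Φ, hsemi, hΦ⟩
  · have hq := (IsOpenQuotientMap.id (X := ℝ)).prodMap (isOpenQuotientMap_proj (ι := ι))
    rw [hq.isQuotientMap.continuous_iff]
    have : Continuous fun p : ℝ × 𝔼 => proj (Φ p.1 p.2) :=
      continuous_proj.comp (Φ.continuous continuous_fst continuous_snd)
    refine this.congr fun p => ?_
    exact (hsemi p.1 p.2).symm
  · intro t₁ t₂ x
    rw [hsemi, Φ.map_add]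
  · intro x
    rw [Φ.map_zero_apply, proj_lift]

end UnitAddTorus

end

/-! ### Fourier coefficients of measures and Kronecker's theorem. -/

section

namespace UnitAddTorus

variable {ι : Type*} [Fintype ι]

local notation "𝔼" => EuclideanSpace ℝ ι

lemma mFourier_proj (k : ι → ℤ) (y : 𝔼) :
    mFourier k (proj y) = Complex.exp (2 * Real.pi * Complex.I * (∑ i, (k i : ℝ) * y i : ℝ)) := by
  have h : mFourier k (proj y) = ∏ i, fourier (k i) (y i : UnitAddCircle) := rfl
  rw [h]
  simp_rw [fourier_coe_apply]
  rw [← Complex.exp_sum]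
  congr 1
  push_cast
  rw [Finset.mul_sum]
  exact Finset.sum_congr rfl fun i _ => by ring

lemma mFourier_apply_add (k : ι → ℤ) (x y : UnitAddTorus ι) :
    mFourier k (x + y) = mFourier k x * mFourier k y := by
  have h : ∀ z, mFourier k z = ∏ i, fourier (k i) (z i) := fun _ => rfl
  simp only [h, fourier_apply, Pi.add_apply, smul_add, AddCircle.toCircle_add, Circle.coe_mul,
    Finset.prod_mul_distrib]

lemma exists_mFourier_proj_smul_ne_one {k : ι → ℤ} {v : 𝔼} (h : ∑ i, (k i : ℝ) * v i ≠ 0) :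
    ∃ t : ℝ, mFourier k (proj (t • v)) ≠ 1 := by
  set a := ∑ i, (k i : ℝ) * v i
  -- At this time the phase is one half, so the character equals `-1`.
  refine ⟨(2 * a)⁻¹, ?_⟩
  have hc : ∀ c : ℝ, ∑ i, (k i : ℝ) * (c • v) i = c * a := fun c => by
    rw [Finset.mul_sum]
    exact Finset.sum_congr rfl fun i _ => by simp only [PiLp.smul_apply, smul_eq_mul]; ring
  have h1 : ∑ i, (k i : ℝ) * ((2 * a)⁻¹ • v) i = 1 / 2 := by
    rw [hc]
    field_simp
  rw [mFourier_proj, h1]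
  have : (2 * Real.pi * Complex.I * ((1 / 2 : ℝ) : ℂ)) = Real.pi * Complex.I := by
    push_cast; ring
  rw [this, Complex.exp_pi_mul_I]
  norm_num

lemma exists_mFourier_ne_one {k : ι → ℤ} (hk : k ≠ 0) : ∃ x, mFourier k x ≠ 1 := by
  obtain ⟨i, hi⟩ := Function.ne_iff.1 hk
  classical
  obtain ⟨t, ht⟩ := exists_mFourier_proj_smul_ne_one (k := k) (v := EuclideanSpace.single i 1)
    (by simpa [Finset.sum_ite_eq'] using hi)
  exact ⟨_, ht⟩

lemma integrable_continuousMap {μ : Measure (UnitAddTorus ι)} [IsFiniteMeasure μ]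
    {F : Type*} [NormedAddCommGroup F] [SecondCountableTopologyEither (UnitAddTorus ι) F]
    {g : UnitAddTorus ι → F} (hg : Continuous g) :
    Integrable g μ := by
  rw [← integrableOn_univ]
  exact hg.continuousOn.integrableOn_compact isCompact_univ

/-- A nontrivial character has zero integral if the measure is invariant under a translation by
an element on which the character is not `1`. -/
lemma integral_mFourier_eq_zero {μ : Measure (UnitAddTorus ι)} {k : ι → ℤ} {a : UnitAddTorus ι}
    (ha : mFourier k a ≠ 1) (hμ : MeasurePreserving (fun x => x + a) μ μ) :
    ∫ x, mFourier k x ∂μ = 0 := by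
  have h1 : ∫ x, mFourier k (x + a) ∂μ = ∫ x, mFourier k x ∂μ :=
    hμ.integral_comp (MeasurableEquiv.addRight a).measurableEmbedding _
  simp only [mFourier_apply_add] at h1
  rw [integral_mul_const] at h1
  have h2 : (∫ x, mFourier k x ∂μ) * (mFourier k a - 1) = 0 := by
    rw [mul_sub, h1, mul_one, sub_self]
  exact (mul_eq_zero.1 h2).resolve_right (sub_ne_zero.2 ha)

/-- A finite measure on the torus is determined by its Fourier coefficients. -/
theorem measure_ext_of_integral_mFourier {μ ν : Measure (UnitAddTorus ι)} [IsFiniteMeasure μ]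
    [IsFiniteMeasure ν] (h : ∀ k, ∫ x, mFourier k x ∂μ = ∫ x, mFourier k x ∂ν) : μ = ν := by
  have hcont : ∀ (ρ : Measure (UnitAddTorus ι)) [IsFiniteMeasure ρ],
      Continuous fun g : C(UnitAddTorus ι, ℂ) => ∫ x, g x ∂ρ := by
    intro ρ _
    refine (LipschitzWith.of_dist_le_mul (K := (ρ.real univ).toNNReal) fun g g' => ?_).continuous
    rw [dist_eq_norm, ← integral_sub (integrable_continuousMap g.continuous)
      (integrable_continuousMap g'.continuous)]
    rw [Real.coe_toNNReal _ measureReal_nonneg, mul_comm, dist_eq_norm]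
    exact norm_integral_le_of_norm_le_const (ae_of_all _ (g - g').norm_coe_le_norm)
  have hall : ∀ g : C(UnitAddTorus ι, ℂ), ∫ x, g x ∂μ = ∫ x, g x ∂ν := by
    have hcl : IsClosed {g : C(UnitAddTorus ι, ℂ) | ∫ x, g x ∂μ = ∫ x, g x ∂ν} :=
      isClosed_eq (hcont μ) (hcont ν)
    have hspan : (Submodule.span ℂ (range (mFourier (d := ι))) : Set C(UnitAddTorus ι, ℂ)) ⊆
        {g : C(UnitAddTorus ι, ℂ) | ∫ x, g x ∂μ = ∫ x, g x ∂ν} := by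
      intro g hg
      induction hg using Submodule.span_induction with
      | mem g hg => obtain ⟨k, rfl⟩ := hg; exact h k
      | zero => simp
      | add f g _ _ hf hg =>
        simp only [mem_ofPred_eq, ContinuousMap.add_apply] at hf hg ⊢
        rw [integral_add (integrable_continuousMap f.continuous)
          (integrable_continuousMap g.continuous),
          integral_add (integrable_continuousMap f.continuous)
          (integrable_continuousMap g.continuous), hf, hg]
      | smul c g _ hg =>
        simp only [mem_ofPred_eq, ContinuousMap.smul_apply] at hg ⊢
        rw [integral_smul, integral_smul, hg]
    intro g
    have hg : g ∈ (Submodule.span ℂ (range (mFourier (d := ι)))).topologicalClosure := by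
      rw [span_mFourier_closure_eq_top]; trivial
    exact closure_minimal hspan hcl hg
  refine ext_of_forall_integral_eq_of_IsFiniteMeasure fun g => ?_
  have := hall ⟨fun x => (g x : ℂ), by fun_prop⟩
  simp only [ContinuousMap.coe_mk, integral_complex_ofReal] at this
  exact_mod_cast this

lemma volume_univ : volume (univ : Set (UnitAddTorus ι)) = 1 := by
  rw [volume_pi, Measure.pi_univ]
  simp

/-- A finite measure on the torus whose nontrivial Fourier coefficients vanish is a multiple of the
Lebesgue measure. -/
theorem measure_eq_smul_volume {ν : Measure (UnitAddTorus ι)} [IsFiniteMeasure ν]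
    (h : ∀ k, k ≠ 0 → ∫ x, mFourier k x ∂ν = 0) : ν = ν univ • volume := by
  have : IsFiniteMeasure (ν univ • (volume : Measure (UnitAddTorus ι))) :=
    ⟨by simp [volume_univ]⟩
  refine measure_ext_of_integral_mFourier fun k => ?_
  rw [integral_smul_measure]
  rcases eq_or_ne k 0 with rfl | hk
  · simp [mFourier_zero, Measure.real, volume_univ]
  · obtain ⟨a, ha⟩ := exists_mFourier_ne_one hk
    rw [h k hk, integral_mFourier_eq_zero ha (measurePreserving_add_right volume a), smul_zero]

/-- The coordinates of `v` are linearly independent over `ℚ`. -/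
def IsNonresonant (v : 𝔼) : Prop :=
  ∀ k : ι → ℤ, k ≠ 0 → ∑ i, (k i : ℝ) * v i ≠ 0

/-- The orbit of `0` under a linear flow, as a group homomorphism. -/
def lineHom (v : 𝔼) : ℝ →+ UnitAddTorus ι where
  toFun t := proj (t • v)
  map_zero' := by simp
  map_add' s t := by rw [add_smul, proj_add]

/-- **Kronecker's theorem**: the orbits of a nonresonant linear flow are dense. -/
theorem IsNonresonant.dense_range {v : 𝔼} (hv : IsNonresonant v) :
    Dense (range fun t : ℝ => proj (t • v)) := by
  set H : AddSubgroup (UnitAddTorus ι) := (lineHom v).range.topologicalClosure with hH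
  have hHc : IsClosed (H : Set (UnitAddTorus ι)) := AddSubgroup.isClosed_topologicalClosure _
  have hmem : ∀ t : ℝ, proj (t • v) ∈ H := fun t =>
    AddSubgroup.le_topologicalClosure _ ⟨t, rfl⟩
  have : CompactSpace H := isCompact_iff_compactSpace.1 hHc.isCompact
  -- Haar measure on the orbit closure `H`, pushed to the torus, is invariant along the line, so it
  -- is a nonzero multiple of Lebesgue measure. The open complement of `H` is then null, hence
  -- empty.
  set ν : Measure (UnitAddTorus ι) := (Measure.addHaar (G := H)).map (↑) with hν
  have hmeas : Measurable ((↑) : H → UnitAddTorus ι) := measurable_subtype_coe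
  have hfin : IsFiniteMeasure ν := Measure.isFiniteMeasure_map _ _
  have hvol : ν = ν univ • volume := by
    refine measure_eq_smul_volume fun k hk => ?_
    obtain ⟨t, ht⟩ := exists_mFourier_proj_smul_ne_one (hv k hk)
    refine integral_mFourier_eq_zero ht ⟨by fun_prop, ?_⟩
    rw [hν, Measure.map_map (by fun_prop) hmeas]
    have : (fun x => x + proj (t • v)) ∘ ((↑) : H → UnitAddTorus ι) =
        (↑) ∘ fun x : H => x + ⟨proj (t • v), hmem t⟩ := by
      ext; rfl
    rw [this, ← Measure.map_map hmeas (by fun_prop),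
      (measurePreserving_add_right Measure.addHaar _).map_eq]
  have hpos : ν univ ≠ 0 := by
    rw [hν, Measure.map_apply hmeas MeasurableSet.univ, preimage_univ]
    exact NeZero.ne _
  have hzero : volume (H : Set (UnitAddTorus ι))ᶜ = 0 := by
    have h1 : ν (H : Set (UnitAddTorus ι))ᶜ = 0 := by
      rw [hν, Measure.map_apply hmeas hHc.measurableSet.compl]
      rw [show ((↑) : H → UnitAddTorus ι) ⁻¹' (H : Set (UnitAddTorus ι))ᶜ = ∅ by ext x; simp]
      exact measure_empty
    rw [hvol] at h1
    simpa [hpos] using h1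
  have h2 : (H : Set (UnitAddTorus ι))ᶜ = ∅ := hHc.isOpen_compl.measure_eq_zero_iff _ |>.1 hzero
  rw [dense_iff_closure_eq]
  exact compl_empty_iff.1 h2

end UnitAddTorus

end

/-! ### Invariant measures of the slowed flow. -/

section

namespace UnitAddTorus

variable {ι : Type*}

lemma exists_proj_eq_abs_eq_norm (x : UnitAddTorus ι) :
    ∃ y : EuclideanSpace ℝ ι, proj y = x ∧ ∀ i, |y i| = ‖x i‖ := by
  have h : ∀ i, ∃ r : ℝ, (r : UnitAddCircle) = x i ∧ |r| = ‖x i‖ := by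
    intro i
    obtain ⟨r, hr⟩ := QuotientAddGroup.mk_surjective (x i)
    refine ⟨r - round r, ?_, ?_⟩
    · rw [← hr, AddCircle.coe_sub, sub_eq_self, AddCircle.coe_eq_zero_iff]
      exact ⟨round r, by simp⟩
    · rw [← hr]
      exact UnitAddCircle.norm_eq.symm
  choose r hr hr' using h
  exact ⟨WithLp.toLp 2 r, funext hr, hr'⟩

variable [Fintype ι]

local notation "𝔼" => EuclideanSpace ℝ ι

/-- A smooth nonnegative function on the torus which vanishes only at the origin, and there so
flatly that its inverse is not integrable. -/
structure IsFlatAtZero (f : UnitAddTorus ι → ℝ) : Prop where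
  contDiff : ContDiff ℝ ∞ fun y => f (proj y)
  nonneg : ∀ x, 0 ≤ f x
  eq_zero_iff : ∀ x, f x = 0 ↔ x = 0
  flat : ∃ C : ℝ, ∀ ε, 0 < ε → ε ≤ 1 → ∀ y : 𝔼, (∀ i, |y i| ≤ ε) →
    f (proj y) ≤ C * ε ^ (Fintype.card ι + 1)

lemma IsFlatAtZero.continuous {f : UnitAddTorus ι → ℝ} (hf : IsFlatAtZero f) : Continuous f :=
  continuous_comp_proj_iff.1 hf.contDiff.continuous

/-- The Lebesgue measure of a small cube centred at the origin of the torus. -/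
lemma volume_cube {ε : ℝ} (h2 : ε ≤ 1 / 2) :
    volume {x : UnitAddTorus ι | ∀ i, ‖x i‖ ≤ ε} = ENNReal.ofReal (2 * ε) ^ Fintype.card ι := by
  have h : {x : UnitAddTorus ι | ∀ i, ‖x i‖ ≤ ε} =
      univ.pi fun _ => Metric.closedBall (0 : UnitAddCircle) ε := by
    ext x; simp
  rw [h, volume_pi, Measure.pi_pi]
  simp only [AddCircle.volume_closedBall]
  rw [Finset.prod_const, min_eq_right (by linarith), Finset.card_univ]

/-- If `f` is flat at the origin and `f • μ` is a multiple of the Lebesgue measure, then `μ` is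
concentrated at the origin. -/
lemma IsFlatAtZero.eq_dirac {f : UnitAddTorus ι → ℝ} (hf : IsFlatAtZero f)
    {μ : Measure (UnitAddTorus ι)} [IsProbabilityMeasure μ] {c : ENNReal} (hc : c ≠ ⊤)
    (hμ : μ.withDensity (fun x => ENNReal.ofReal (f x)) = c • volume) :
    μ = Measure.dirac 0 := by
  have hmeas : Measurable fun x => ENNReal.ofReal (f x) := hf.continuous.measurable.ennreal_ofReal
  obtain ⟨C, hC⟩ := hf.flat
  have hC0 : 0 ≤ C := by
    have := (hf.nonneg 0).trans (proj_zero (ι := ι) ▸ hC 1 one_pos le_rfl 0 (by simp))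
    simpa using this
  have key : ∀ ε : ℝ, 0 < ε → ε ≤ 1 / 2 → c.toReal ≤ C * ε := by
    -- The bound `ε ≤ 1 / 2` keeps the cube from wrapping around the torus, so its volume is exactly
    -- `(2ε)^n`.
    intro ε h0 h2
    set B := {x : UnitAddTorus ι | ∀ i, ‖x i‖ ≤ ε} with hB
    have hBm : MeasurableSet B := by
      have : IsClosed B := by
        simp only [hB, ofPred_forall]
        exact isClosed_iInter fun i => isClosed_le (by fun_prop) continuous_const
      exact this.measurableSet
    have h1 : c * ENNReal.ofReal (2 * ε) ^ Fintype.card ι ≤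
        ENNReal.ofReal (C * ε ^ (Fintype.card ι + 1)) := by
      rw [← volume_cube (ι := ι) h2, ← smul_eq_mul, ← Measure.smul_apply, ← hμ,
        withDensity_apply _ hBm]
      calc ∫⁻ x in B, ENNReal.ofReal (f x) ∂μ
          ≤ ∫⁻ _ in B, ENNReal.ofReal (C * ε ^ (Fintype.card ι + 1)) ∂μ := by
            refine setLIntegral_mono measurable_const fun x hx => ENNReal.ofReal_le_ofReal ?_
            obtain ⟨y, rfl, hy⟩ := exists_proj_eq_abs_eq_norm x
            exact hC ε h0 (by linarith) y fun i => (hy i).trans_le (hx i)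
        _ ≤ ENNReal.ofReal (C * ε ^ (Fintype.card ι + 1)) := by
            rw [setLIntegral_const]
            exact mul_le_of_le_one_right' prob_le_one
    have h3 := ENNReal.toReal_mono ENNReal.ofReal_ne_top h1
    rw [ENNReal.toReal_mul, ENNReal.toReal_pow, ENNReal.toReal_ofReal (by positivity),
      ENNReal.toReal_ofReal (by positivity), pow_succ] at h3
    have h4 : ε ^ Fintype.card ι ≤ (2 * ε) ^ Fintype.card ι := by gcongr; linarith
    have h5 : c.toReal * ε ^ Fintype.card ι ≤ C * ε * ε ^ Fintype.card ι :=
      (mul_le_mul_of_nonneg_left h4 ENNReal.toReal_nonneg).trans (h3.trans_eq (by ring))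
    exact le_of_mul_le_mul_right h5 (by positivity)
  have hc0 : c = 0 := by
    refine ((ENNReal.toReal_eq_zero_iff c).1 ?_).resolve_right hc
    refine le_antisymm ?_ ENNReal.toReal_nonneg
    have hlim : Tendsto (fun ε : ℝ => C * ε) (𝓝[>] 0) (𝓝 0) := by
      have : Tendsto (fun ε : ℝ => C * ε) (𝓝 0) (𝓝 (C * 0)) := by
        exact (continuous_const.mul continuous_id).tendsto 0
      rw [mul_zero] at this
      exact this.mono_left nhdsWithin_le_nhds
    refine ge_of_tendsto hlim ?_
    filter_upwards [Ioc_mem_nhdsGT (show (0 : ℝ) < 1 / 2 by norm_num)] with ε hε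
    exact key ε hε.1 hε.2
  rw [hc0, zero_smul, withDensity_eq_zero_iff hmeas.aemeasurable] at hμ
  have hae : (id : UnitAddTorus ι → UnitAddTorus ι) =ᵐ[μ] fun _ => 0 := by
    filter_upwards [hμ] with x hx
    have : f x ≤ 0 := by simpa using hx
    exact (hf.eq_zero_iff x).1 (le_antisymm this (hf.nonneg x))
  have h : μ.map id = μ.map fun _ => (0 : UnitAddTorus ι) := Measure.map_congr hae
  rwa [Measure.map_id, Measure.map_const, measure_univ, one_smul] at h

/-- Characters are eigenfunctions of differentiation along `v`; slowing multiplies the derivative by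
`f`. -/
lemma hasDerivAt_mFourier_flow {f : UnitAddTorus ι → ℝ} {v : 𝔼}
    {φ : Flow ℝ (UnitAddTorus ι)} {Φ : Flow ℝ 𝔼} (hφ : ∀ (t : ℝ) y, φ t (proj y) = proj (Φ t y))
    (hΦ : ∀ y (t : ℝ), HasDerivAt (fun s => Φ s y) (f (proj (Φ t y)) • v) t)
    (k : ι → ℤ) (x : UnitAddTorus ι) (t : ℝ) :
    HasDerivAt (fun s => mFourier k (φ s x))
      (2 * Real.pi * Complex.I * (∑ i, (k i : ℝ) * v i : ℝ) *
        ((f (φ t x) : ℂ) * mFourier k (φ t x))) t := by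
  obtain ⟨y, rfl⟩ := proj_surjective x
  simp only [hφ, mFourier_proj]
  have h1 : HasDerivAt (fun s => ∑ i, (k i : ℝ) * (Φ s y) i)
      (∑ i, (k i : ℝ) * (f (proj (Φ t y)) • v) i) t := by
    refine HasDerivAt.fun_sum fun i _ => HasDerivAt.const_mul _ ?_
    exact (EuclideanSpace.proj (𝕜 := ℝ) i).hasFDerivAt.comp_hasDerivAt t (hΦ y t)
  have h2 := (h1.ofReal_comp.const_mul (2 * Real.pi * Complex.I)).cexp
  convert h2 using 1
  have h3 : ∑ i, (k i : ℝ) * (f (proj (Φ t y)) • v) i =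
      f (proj (Φ t y)) * ∑ i, (k i : ℝ) * v i := by
    rw [Finset.mul_sum]
    exact Finset.sum_congr rfl fun i _ => by simp only [PiLp.smul_apply, smul_eq_mul]; ring
  rw [h3]
  push_cast
  ring

/-- Every invariant measure of the slowed down flow becomes, after multiplication by the slowing
factor, invariant under the linear flow; here on the level of Fourier coefficients. -/
lemma integral_mul_mFourier_eq_zero {f : UnitAddTorus ι → ℝ} {v : 𝔼}
    {φ : Flow ℝ (UnitAddTorus ι)} {Φ : Flow ℝ 𝔼} (hv : IsNonresonant v) (hf : Continuous f)
    (hφ : ∀ (t : ℝ) y, φ t (proj y) = proj (Φ t y))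
    (hΦ : ∀ y (t : ℝ), HasDerivAt (fun s => Φ s y) (f (proj (Φ t y)) • v) t)
    {μ : Measure (UnitAddTorus ι)} [IsFiniteMeasure μ]
    (hμ : ∀ t, MeasurePreserving (φ t) μ μ) {k : ι → ℤ} (hk : k ≠ 0) :
    ∫ x, (f x : ℂ) * mFourier k x ∂μ = 0 := by
  set a : ℂ := 2 * Real.pi * Complex.I * (∑ i, (k i : ℝ) * v i : ℝ) with ha
  have ha0 : a ≠ 0 := by
    rw [ha]
    exact mul_ne_zero Complex.two_pi_I_ne_zero (by exact_mod_cast hv k hk)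
  obtain ⟨C, hC⟩ := (isCompact_range hf).isBounded.exists_norm_le
  have hcont : ∀ t, Continuous fun x => a * ((f (φ t x) : ℂ) * mFourier k (φ t x)) := by
    intro t; fun_prop
  have hd := (hasDerivAt_integral_of_dominated_loc_of_deriv_le (μ := μ) (s := univ)
    (x₀ := (0 : ℝ)) (F := fun t x => mFourier k (φ t x)) (bound := fun _ => ‖a‖ * C)
    (F' := fun t x => a * ((f (φ t x) : ℂ) * mFourier k (φ t x))) univ_mem
    (Eventually.of_forall fun t => (integrable_continuousMap (by fun_prop)).aestronglyMeasurable)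
    (integrable_continuousMap (by fun_prop))
    (integrable_continuousMap (hcont 0)).aestronglyMeasurable
    (ae_of_all _ fun x t _ => ?_) (integrable_const _)
    (ae_of_all _ fun x t _ => hasDerivAt_mFourier_flow hφ hΦ k x t)).2
  -- Invariance makes the integral constant in `t`, so the derivative at `0` computed in `hd`
  -- vanishes.
  · have hconst : (fun t => ∫ x, mFourier k (φ t x) ∂μ) = fun _ => ∫ x, mFourier k x ∂μ := by
      funext t
      conv_rhs => rw [← (hμ t).map_eq]
      exact (integral_map (hμ t).measurable.aemeasurable
        (mFourier k).continuous.aestronglyMeasurable).symm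
    rw [hconst] at hd
    have h0 := hd.unique (hasDerivAt_const _ _)
    simp only [Flow.map_zero, id] at h0
    rw [integral_const_mul] at h0
    exact (mul_eq_zero.1 h0).resolve_left ha0
  · rw [norm_mul a]
    have h1 : ‖mFourier k (φ t x)‖ ≤ 1 :=
      ((mFourier k).norm_coe_le_norm _).trans_eq mFourier_norm
    have h2 : ‖f (φ t x)‖ ≤ C := hC _ ⟨_, rfl⟩
    gcongr
    rw [norm_mul, Complex.norm_real]
    exact (mul_le_mul h2 h1 (norm_nonneg _) ((norm_nonneg _).trans h2)).trans_eq (mul_one C)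

theorem IsFlatAtZero.eq_dirac_of_invariant {f : UnitAddTorus ι → ℝ} {v : 𝔼}
    {φ : Flow ℝ (UnitAddTorus ι)} {Φ : Flow ℝ 𝔼} (hf : IsFlatAtZero f) (hv : IsNonresonant v)
    (hφ : ∀ (t : ℝ) y, φ t (proj y) = proj (Φ t y))
    (hΦ : ∀ y (t : ℝ), HasDerivAt (fun s => Φ s y) (f (proj (Φ t y)) • v) t)
    {μ : Measure (UnitAddTorus ι)} [IsProbabilityMeasure μ]
    (hμ : ∀ t, MeasurePreserving (φ t) μ μ) : μ = Measure.dirac 0 := by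
  have hmeas : Measurable fun x => ENNReal.ofReal (f x) := hf.continuous.measurable.ennreal_ofReal
  have hfin : IsFiniteMeasure (μ.withDensity fun x => ENNReal.ofReal (f x)) :=
    isFiniteMeasure_withDensity_ofReal (integrable_continuousMap hf.continuous).2
  refine hf.eq_dirac (measure_ne_top _ univ) (measure_eq_smul_volume fun k hk => ?_)
  rw [integral_withDensity_eq_integral_toReal_smul hmeas
    (ae_of_all _ fun _ => ENNReal.ofReal_lt_top)]
  refine Eq.trans (integral_congr_ae (ae_of_all _ fun x => ?_))
    (integral_mul_mFourier_eq_zero hv hf.continuous hφ hΦ hμ hk)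
  simp only [ENNReal.toReal_ofReal (hf.nonneg x)]
  exact Complex.real_smul

end UnitAddTorus

end

/-! ### Dense orbits and fixed points of the slowed flow. -/

section

namespace UnitAddTorus

variable {ι : Type*} [Fintype ι]

local notation "𝔼" => EuclideanSpace ℝ ι

lemma IsNonresonant.apply_ne_zero {v : 𝔼} (hv : IsNonresonant v) (i : ι) : v i ≠ 0 := by
  classical
  have h := hv (Pi.single i 1) (by simp)
  simpa [Pi.single_apply] using h

lemma IsNonresonant.lineHom_injective [Nontrivial ι] {v : 𝔼} (hv : IsNonresonant v) :
    Function.Injective (lineHom v) := by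
  classical
  rw [injective_iff_map_eq_zero]
  intro t ht
  by_contra h0
  obtain ⟨i, j, hij⟩ := exists_pair_ne ι
  have h := proj_eq_zero_iff.1 ht
  obtain ⟨m, hm⟩ := h i
  obtain ⟨n, hn⟩ := h j
  simp only [PiLp.smul_apply, smul_eq_mul] at hm hn
  -- From `m = t v i` and `n = t v j` one gets `n v i - m v j = 0`, a resonance, nontrivial because
  -- `n ≠ 0`.
  refine hv (Pi.single i n - Pi.single j m) (fun hk => ?_) ?_
  · have h1 := congrFun hk i
    have h2 : n = 0 := by simpa [hij] using h1
    rw [h2, Int.cast_zero] at hn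
    exact mul_ne_zero h0 (hv.apply_ne_zero j) hn.symm
  · have h3 : ∀ l : ι, (((Pi.single i n - Pi.single j m : ι → ℤ) l : ℤ) : ℝ) * v l =
        (if l = i then (n : ℝ) * v l else 0) - (if l = j then (m : ℝ) * v l else 0) := by
      intro l
      simp only [Pi.sub_apply, Pi.single_apply]
      split_ifs <;> push_cast <;> ring
    simp only [h3, Finset.sum_sub_distrib, Finset.sum_ite_eq', Finset.mem_univ, if_true]
    rw [hm, hn]
    ring

/-- A point of order two cannot lie on an injective image of the torsion-free group `ℝ`. -/
lemma IsNonresonant.exists_notMem_range [Nontrivial ι] {v : 𝔼} (hv : IsNonresonant v) :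
    ∃ q, ∀ t : ℝ, proj (t • v) ≠ q := by
  classical
  obtain ⟨i⟩ : Nonempty ι := inferInstance
  refine ⟨proj (EuclideanSpace.single i (1 / 2)), fun t ht => ?_⟩
  have h1 : lineHom v (t + t) = 0 := by
    rw [map_add]
    change proj (t • v) + proj (t • v) = 0
    rw [ht, ← proj_add, proj_eq_zero_iff]
    intro j
    by_cases h : j = i
    · exact ⟨1, by simp [h]; norm_num⟩
    · exact ⟨0, by simp [h]⟩
  have h2 : t + t = 0 := hv.lineHom_injective (by rw [h1, map_zero])
  have h3 : t = 0 := by linarith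
  rw [h3, zero_smul, proj_zero, eq_comm, proj_eq_zero_iff] at ht
  obtain ⟨n, hn⟩ := ht i
  have h4 : (n : ℝ) * 2 = 1 := by rw [hn]; simp
  have h5 : n * 2 = 1 := by exact_mod_cast h4
  omega

/-- An orbit of the slowed down flow which avoids the zeros of the slowing factor traverses the
whole orbit of the linear flow. -/
lemma exists_flow_eq_add_smul {f : UnitAddTorus ι → ℝ} {v : 𝔼} {Φ : Flow ℝ 𝔼}
    (hf : Continuous f) (hΦ : ∀ y (t : ℝ), HasDerivAt (fun s => Φ s y) (f (proj (Φ t y)) • v) t)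
    {y : 𝔼} (hpos : ∀ s : ℝ, 0 < f (proj (y + s • v))) (σ : ℝ) : ∃ t, Φ t y = y + σ • v := by
  -- `s t` is the distance along the line, in units of `v`, covered by time `t`; `G` below is the
  -- time needed to cover a given distance.
  set s : ℝ → ℝ := fun t => ∫ r in (0 : ℝ)..t, f (proj (Φ r y)) with hs
  have hcont : Continuous fun r => f (proj (Φ r y)) :=
    hf.comp (continuous_proj.comp (Φ.continuous continuous_id continuous_const))
  have hsd : ∀ t, HasDerivAt s (f (proj (Φ t y))) t := fun t =>
    (hcont.integral_hasStrictDerivAt 0 t).hasDerivAt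
  have hΦs : ∀ t, Φ t y = y + s t • v := by
    intro t
    have hd : ∀ t, HasDerivAt (fun t => Φ t y - s t • v) 0 t := fun t => by
      have h := (hΦ y t).sub ((hsd t).smul_const v)
      rwa [sub_self] at h
    have h := is_const_of_deriv_eq_zero (fun t => (hd t).differentiableAt)
      (fun t => (hd t).deriv) t 0
    have h0 : s 0 = 0 := intervalIntegral.integral_same
    simp only [h0, zero_smul, sub_zero, Φ.map_zero_apply] at h
    exact sub_eq_iff_eq_add.1 h
  set G : ℝ → ℝ := fun σ => ∫ r in (0 : ℝ)..σ, (f (proj (y + r • v)))⁻¹ with hG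
  have hcont' : Continuous fun r : ℝ => (f (proj (y + r • v)))⁻¹ :=
    (hf.comp (continuous_proj.comp (by fun_prop))).inv₀ fun r => (hpos r).ne'
  have hGd : ∀ σ, HasDerivAt G (f (proj (y + σ • v)))⁻¹ σ := fun σ =>
    (hcont'.integral_hasStrictDerivAt 0 σ).hasDerivAt
  have hGinj : Function.Injective G :=
    (strictMono_of_deriv_pos fun σ => by rw [(hGd σ).deriv]; exact inv_pos.2 (hpos σ)).injective
  have hGs : ∀ t, G (s t) = t := by
    intro t
    have hd : ∀ t, HasDerivAt (fun t => G (s t) - t) 0 t := fun t => by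
      have h1 := ((hGd (s t)).comp t (hsd t)).sub (hasDerivAt_id t)
      rw [← hΦs t, inv_mul_cancel₀ (by rw [hΦs t]; exact (hpos _).ne'), sub_self] at h1
      exact h1
    have := is_const_of_deriv_eq_zero (fun t => (hd t).differentiableAt)
      (fun t => (hd t).deriv) t 0
    simpa [hs, hG, sub_eq_zero] using this
  -- Since `G ∘ s = id` and `G` is injective, also `s ∘ G = id`.
  exact ⟨G σ, by rw [hΦs, hGinj (hGs (G σ))]⟩

/-- A nonresonant linear flow, slowed down at a point so strongly that the inverse of the slowing
factor is not integrable, is topologically chaotic but statistically trivial. -/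
theorem IsFlatAtZero.isChaoticTrivialFlow [Nontrivial ι] {f : UnitAddTorus ι → ℝ} {v : 𝔼}
    {φ : Flow ℝ (UnitAddTorus ι)} {Φ : Flow ℝ 𝔼} (hf : IsFlatAtZero f) (hv : IsNonresonant v)
    (hφ : ∀ (t : ℝ) y, φ t (proj y) = proj (Φ t y))
    (hΦ : ∀ y (t : ℝ), HasDerivAt (fun s => Φ s y) (f (proj (Φ t y)) • v) t) :
    ChaosTriviality.IsChaoticTrivialFlow φ := by
  have hfix : ∀ x, ChaosTriviality.IsFixedPoint φ x ↔ x = 0 := by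
    intro x
    constructor
    · intro hx
      classical
      obtain ⟨i⟩ : Nonempty ι := inferInstance
      -- A coordinate character is constant along a stationary orbit, so its derivative, a nonzero
      -- multiple of `f x`, vanishes.
      have h1 := hasDerivAt_mFourier_flow hφ hΦ (Pi.single i 1) x 0
      simp only [hx _] at h1
      have h2 := (hasDerivAt_const (0 : ℝ) (mFourier (Pi.single i 1) x)).unique h1
      have h3 : mFourier (Pi.single i 1) x ≠ 0 := by
        obtain ⟨y, rfl⟩ := proj_surjective x
        rw [mFourier_proj]
        exact Complex.exp_ne_zero _
      have h4 := hv (Pi.single i 1) (by simp)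
      have h5 : (f x : ℂ) = 0 := by
        by_contra h
        exact mul_ne_zero (mul_ne_zero Complex.two_pi_I_ne_zero (by exact_mod_cast h4))
          (mul_ne_zero h h3) h2.symm
      exact (hf.eq_zero_iff x).1 (by exact_mod_cast h5)
    · rintro rfl
      obtain ⟨K, hK⟩ := exists_lipschitzWith_comp_proj
        (hf.contDiff.of_le (by norm_cast))
      have h := ODE_solution_unique_univ (v := fun _ y => f (proj y) • v) (s := fun _ => univ)
        (f := fun t => Φ t 0) (g := fun _ => 0) (t₀ := 0)
        (fun _ => ((ContinuousLinearMap.toSpanSingleton ℝ v).lipschitz.comp hK).lipschitzOnWith)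
        (fun t => ⟨hΦ _ t, mem_univ _⟩)
        (fun t => ⟨by
          rw [proj_zero, (hf.eq_zero_iff 0).2 rfl, zero_smul]
          exact hasDerivAt_const _ _, mem_univ _⟩)
        (by simp)
      intro t
      rw [← proj_zero (ι := ι), hφ, congrFun h t]
  refine ⟨?_, 0, hfix, fun μ => ⟨fun h => ?_, ?_⟩⟩
  -- The line through `-q` meets the origin only if `q` lies on the line through `0`, which it does
  -- not.
  · obtain ⟨q, hq⟩ := hv.exists_notMem_range
    obtain ⟨y, hy⟩ := proj_surjective (-q)
    have hpos : ∀ s : ℝ, 0 < f (proj (y + s • v)) := fun s => by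
      refine (hf.nonneg _).lt_of_ne' fun h => hq s ?_
      have h1 := (hf.eq_zero_iff _).1 h
      rwa [proj_add, hy, neg_add_eq_zero, eq_comm] at h1
    refine ⟨proj y, ?_⟩
    have hd : Dense (range fun t : ℝ => proj y + proj (t • v)) := by
      have h := (Homeomorph.addLeft (proj y)).surjective.denseRange.dense_image
        (Homeomorph.addLeft (proj y)).continuous hv.dense_range
      rwa [← range_comp] at h
    refine hd.mono ?_
    rintro _ ⟨σ, rfl⟩
    obtain ⟨t, ht⟩ := exists_flow_eq_add_smul hf.continuous hΦ hpos σ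
    exact ⟨t, by
      change φ t (proj y) = proj y + proj (σ • v)
      rw [hφ, ht, proj_add]⟩
  · have := h.isProbabilityMeasure
    exact hf.eq_dirac_of_invariant hv hφ hΦ h.invariant
  · rintro rfl
    refine ⟨inferInstance, fun t => ⟨(φ.continuous_toFun t).measurable, ?_⟩, fun B hB _ => ?_⟩
    · rw [Measure.map_dirac' (φ.continuous_toFun t).measurable, (hfix 0).2 rfl t]
    · by_cases h : (0 : UnitAddTorus ι) ∈ B <;> simp [h, hB]

end UnitAddTorus

end

/-! ### Slowed fields and the `C^r` topology. -/

section

namespace UnitAddTorus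

open ChaosTriviality

variable {ι : Type*} [Fintype ι]

local notation "𝔼" => EuclideanSpace ℝ ι

variable (ι) in
/-- The smooth functions on the torus. -/
def smoothFunctions : Submodule ℝ (UnitAddTorus ι → ℝ) where
  carrier := {f | ContDiff ℝ ∞ fun y => f (proj y)}
  add_mem' {f g} hf hg := by
    rw [mem_ofPred_eq] at hf hg ⊢
    exact hf.add hg
  zero_mem' := by
    rw [mem_ofPred_eq]
    exact contDiff_const
  smul_mem' c f hf := by
    rw [mem_ofPred_eq] at hf ⊢
    exact contDiff_const.smul hf

lemma mem_smoothFunctions {f : UnitAddTorus ι → ℝ} :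
    f ∈ smoothFunctions ι ↔ ContDiff ℝ ∞ fun y => f (proj y) := Iff.rfl

/-- The vector field `f • v` on the torus. -/
def field (v : 𝔼) (r : ℕ∞) : smoothFunctions ι →ₗ[ℝ] VectorFields 𝔼 (UnitAddTorus ι) r where
  toFun f :=
    { toFun := fun x => (f.1 x • v : 𝔼)
      contMDiff_toFun := by
        have hr : (r : WithTop ℕ∞) ≤ ∞ := by exact_mod_cast le_top
        exact ContMDiff.smul_section
          (V := (TangentSpace 𝓘(ℝ, 𝔼) : UnitAddTorus ι → Type _)) (s := fun _ => v)
          (contMDiff_of_contDiff_comp_proj hr ((mem_smoothFunctions.1 f.2).of_le hr))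
          (contMDiff_const_section v) }
  map_add' f g := by
    ext x
    exact add_smul (f.1 x) (g.1 x) v
  map_smul' c f := by
    ext x
    exact mul_smul c (f.1 x) v

lemma field_apply (v : 𝔼) (r : ℕ∞) (f : smoothFunctions ι) (x : UnitAddTorus ι) :
    field v r f x = (f.1 x • v : 𝔼) := rfl

lemma field_injective {v : 𝔼} (hv : v ≠ 0) (r : ℕ∞) : Function.Injective (field v r) := by
  intro f g h
  refine Subtype.ext (funext fun x => ?_)
  have hx : (f.1 x • v : 𝔼) = g.1 x • v := congrArg (fun Y => Y x) h
  exact smul_left_injective ℝ hv hx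

lemma localExpression_eq {r : ℕ∞} {Y : VectorFields 𝔼 (UnitAddTorus ι) r} {x₀ : UnitAddTorus ι}
    {y : 𝔼} (hy : y ∈ (chartAt 𝔼 x₀).target) : localExpression x₀ Y y = Y (proj y) := by
  have h := (hasMFDerivAt_chartAt ((chartAt 𝔼 x₀).map_target hy)).mfderiv
  exact DFunLike.congr_fun h (Y (proj y))

lemma continuous_iteratedFDeriv_localExpression {r : ℕ∞} (x₀ : UnitAddTorus ι) {k : ℕ}
    (hk : (k : ℕ∞) ≤ r) :
    Continuous fun Y : VectorFields 𝔼 (UnitAddTorus ι) r =>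
      UniformOnFun.ofFun {K : Set 𝔼 | IsCompact K ∧ K ⊆ (chartAt 𝔼 x₀).target}
        (iteratedFDeriv ℝ k (localExpression x₀ Y)) :=
  continuous_iInf_dom (continuous_iInf_dom (continuous_iInf_dom (i := hk) continuous_induced_dom))

/-- This is the order-zero part of the topology on a one-point compact set. It yields the Hausdorff
property used to embed cubes. -/
lemma continuous_eval (r : ℕ∞) (x : UnitAddTorus ι) :
    Continuous fun Y : VectorFields 𝔼 (UnitAddTorus ι) r => (Y x : 𝔼) := by
  set y := chartAt 𝔼 x x
  have hy : y ∈ (chartAt 𝔼 x).target := mem_chart_target 𝔼 x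
  have h1 := (UniformOnFun.uniformContinuous_eval_of_mem (𝔼 [×0]→L[ℝ] 𝔼)
    {K : Set 𝔼 | IsCompact K ∧ K ⊆ (chartAt 𝔼 x).target} (mem_singleton y)
    ⟨isCompact_singleton, singleton_subset_iff.2 hy⟩).continuous.comp
      (continuous_iteratedFDeriv_localExpression (r := r) x (k := 0) (by simp))
  have h2 := (continuous_eval_const (F := 𝔼 [×0]→L[ℝ] 𝔼) 0).comp h1
  refine h2.congr fun Y => ?_
  change localExpression x Y y = Y x
  rw [localExpression_eq hy, proj_chartAt (mem_chart_source 𝔼 x)]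

instance (r : ℕ∞) : T2Space (VectorFields 𝔼 (UnitAddTorus ι) r) := by
  refine ⟨fun Y Z h => ?_⟩
  obtain ⟨x, hx⟩ : ∃ x, Y x ≠ Z x := by
    by_contra! hc
    exact h (ContMDiffSection.ext hc)
  have : T2Space (TangentSpace 𝓘(ℝ, 𝔼) x) := inferInstanceAs (T2Space 𝔼)
  exact separated_by_continuous (continuous_eval r x) hx

/-- Finite linear combinations of the fields `f • v` depend continuously on the coefficients. -/
lemma continuous_field_sum {J : Type*} [Fintype J] (v : 𝔼) (r : ℕ∞) (f : J → smoothFunctions ι) :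
    Continuous fun c : J → ℝ => field v r (∑ j, c j • f j) := by
  refine continuous_iInf_rng.2 fun x₀ => continuous_iInf_rng.2 fun k =>
    continuous_iInf_rng.2 fun _ => continuous_induced_rng.2 ?_
  set D : J → 𝔼 → 𝔼 [×k]→L[ℝ] 𝔼 := fun j => iteratedFDeriv ℝ k fun y => (f j).1 (proj y) • v
  have hsm : ∀ j, ContDiff ℝ k fun y => (f j).1 (proj y) • v := fun j =>
    ((mem_smoothFunctions.1 (f j).2).smul contDiff_const).of_le (by exact_mod_cast le_top)
  have hD : ∀ j, Continuous (D j) := fun j => (hsm j).continuous_iteratedFDeriv le_rfl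
  have heq : ∀ (c : J → ℝ) y, y ∈ (chartAt 𝔼 x₀).target →
      iteratedFDeriv ℝ k (localExpression x₀ (field v r (∑ j, c j • f j))) y =
        ∑ j, c j • D j y := by
    intro c y hy
    have h1 : localExpression x₀ (field v r (∑ j, c j • f j)) =ᶠ[𝓝 y]
        fun y => ∑ j, c j • ((f j).1 (proj y) • v) := by
      filter_upwards [(chartAt 𝔼 x₀).open_target.mem_nhds hy] with z hz
      rw [localExpression_eq hz, field_apply]
      simp only [Submodule.coe_sum, Submodule.coe_smul, Finset.sum_apply, Pi.smul_apply,
        Finset.sum_smul, smul_eq_mul, mul_smul]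
    rw [(Filter.EventuallyEq.iteratedFDeriv ℝ h1 k).eq_of_nhds, iteratedFDeriv_fun_sum_apply
      fun j _ => ((hsm j).const_smul (c j)).contDiffAt]
    exact Finset.sum_congr rfl fun j _ => iteratedFDeriv_const_smul_apply' (hsm j).contDiffAt
  -- Currying a jointly continuous map turns continuity in the coefficients into uniform convergence
  -- on compact sets.
  set G : C((J → ℝ) × 𝔼, 𝔼 [×k]→L[ℝ] 𝔼) :=
    ⟨fun p => ∑ j, p.1 j • D j p.2, by fun_prop⟩
  rw [continuous_iff_continuousAt]
  intro c
  refine UniformOnFun.tendsto_iff_tendstoUniformlyOn.2 fun K hK => ?_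
  have h := ContinuousMap.tendsto_iff_forall_isCompact_tendstoUniformlyOn.1
    (G.curry.continuous.tendsto c) K hK.1
  refine (h.congr (Eventually.of_forall fun c' y hy => ?_)).congr_right fun y hy => ?_
  · exact (heq c' y (hK.2 hy)).symm
  · exact (heq c y (hK.2 hy)).symm

/-- A flat slowing factor yields a topologically chaotic but statistically trivial field. -/
theorem IsFlatAtZero.field_mem [Nontrivial ι] {v : 𝔼} (hv : IsNonresonant v) (r : ℕ∞)
    {f : smoothFunctions ι} (hf : IsFlatAtZero f.1) :
    field v r f ∈ chaoticTrivialFields 𝔼 (UnitAddTorus ι) r := by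
  obtain ⟨φ, Φ, hφ, hΦ⟩ := exists_flow v (f := f.1) (hf.contDiff.of_le (by norm_cast))
  refine ⟨φ, fun x t => ?_, hf.isChaoticTrivialFlow hv hφ hΦ⟩
  obtain ⟨y, rfl⟩ := proj_surjective x
  have h := (hasMFDerivAt_proj (Φ t y)).comp t (hΦ y t).hasFDerivAt.hasMFDerivAt
  refine (h.congr_of_eventuallyEq (f₁ := fun s => φ s (proj y))
    (Eventually.of_forall fun s => hφ s y)).congr_mfderiv ?_
  ext
  change (1 : ℝ) • (f.1 (proj (Φ t y)) • v) = (1 : ℝ) • (f.1 (φ t (proj y)) • v)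
  rw [hφ]

/-- The fields `f • v` for all slowing factors `f` flat at zero. -/
def slowedFields (v : 𝔼) (r : ℕ∞) : Set (VectorFields 𝔼 (UnitAddTorus ι) r) :=
  field v r '' {f | IsFlatAtZero f.1}

lemma convex_isFlatAtZero : Convex ℝ {f : smoothFunctions ι | IsFlatAtZero f.1} := by
  rintro f hf g hg a b ha hb hab
  refine ⟨(a • f + b • g).2, fun x => ?_, fun x => ?_, ?_⟩
  · exact add_nonneg (mul_nonneg ha (hf.nonneg x)) (mul_nonneg hb (hg.nonneg x))
  · have h1 := mul_nonneg ha (hf.nonneg x)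
    have h2 := mul_nonneg hb (hg.nonneg x)
    change a * f.1 x + b * g.1 x = 0 ↔ x = 0
    rw [add_eq_zero_iff_of_nonneg h1 h2, mul_eq_zero, mul_eq_zero, hf.eq_zero_iff, hg.eq_zero_iff]
    refine ⟨fun h => ?_, fun h => ⟨.inr h, .inr h⟩⟩
    by_contra hx
    have ha0 : a = 0 := h.1.resolve_right hx
    have hb0 : b = 0 := h.2.resolve_right hx
    linarith
  · obtain ⟨C, hC⟩ := hf.flat
    obtain ⟨C', hC'⟩ := hg.flat
    refine ⟨a * C + b * C', fun ε h0 h1 y hy => ?_⟩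
    rw [add_mul, mul_assoc, mul_assoc]
    exact add_le_add (mul_le_mul_of_nonneg_left (hC ε h0 h1 y hy) ha)
      (mul_le_mul_of_nonneg_left (hC' ε h0 h1 y hy) hb)

lemma isPreconnected_slowedFields (v : 𝔼) (r : ℕ∞) : IsPreconnected (slowedFields v r) := by
  refine isPreconnected_of_forall_pair ?_
  rintro _ ⟨f, hf, rfl⟩ _ ⟨g, hg, rfl⟩
  have hcont : Continuous fun t : ℝ => field v r (∑ j, ![1 - t, t] j • ![f, g] j) :=
    (continuous_field_sum v r ![f, g]).comp
      (continuous_pi fun j => by fin_cases j <;> simp <;> fun_prop)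
  simp only [Fin.sum_univ_two, Matrix.cons_val_zero, Matrix.cons_val_one] at hcont
  refine ⟨(fun t : ℝ => field v r ((1 - t) • f + t • g)) '' Icc 0 1, ?_, ⟨0, by simp⟩,
    ⟨1, by simp⟩, isPreconnected_Icc.image _ hcont.continuousOn⟩
  rintro _ ⟨t, ht, rfl⟩
  exact ⟨_, convex_isFlatAtZero hf hg (by linarith [ht.2]) ht.1 (by ring), rfl⟩

end UnitAddTorus

end

/-! ### Explicit slowing factors, cubes and nonresonant vectors. -/

section

namespace UnitAddTorus

open ChaosTriviality Polynomial

variable {ι : Type*}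

/-- The function `x ↦ cos (2 π x i)` on the torus. -/
def cosCoord (i : ι) (x : UnitAddTorus ι) : ℝ := (fourier 1 (x i)).re

lemma cosCoord_proj (i : ι) (y : EuclideanSpace ℝ ι) :
    cosCoord i (proj y) = Real.cos (2 * Real.pi * y i) := by
  have h : cosCoord i (proj y) = (fourier 1 (y i : UnitAddCircle)).re := rfl
  rw [h, fourier_coe_apply, ← Complex.exp_ofReal_mul_I_re]
  congr 2
  push_cast
  ring

lemma neg_one_le_cosCoord (i : ι) (x : UnitAddTorus ι) : -1 ≤ cosCoord i x := by
  obtain ⟨y, rfl⟩ := proj_surjective x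
  rw [cosCoord_proj]
  exact Real.neg_one_le_cos _

lemma cosCoord_le_one (i : ι) (x : UnitAddTorus ι) : cosCoord i x ≤ 1 := by
  obtain ⟨y, rfl⟩ := proj_surjective x
  rw [cosCoord_proj]
  exact Real.cos_le_one _

variable [Fintype ι]

local notation "𝔼" => EuclideanSpace ℝ ι

/-- A function on the torus which is flat at zero. -/
def flatFun (x : UnitAddTorus ι) : ℝ := (∑ i, (1 - cosCoord i x)) ^ (Fintype.card ι + 1)

lemma flatFun_nonneg (x : UnitAddTorus ι) : 0 ≤ flatFun x :=
  pow_nonneg (Finset.sum_nonneg fun i _ => sub_nonneg.2 (cosCoord_le_one i x)) _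

lemma flatFun_eq_zero_iff (x : UnitAddTorus ι) : flatFun x = 0 ↔ x = 0 := by
  obtain ⟨y, rfl⟩ := proj_surjective x
  rw [flatFun, pow_eq_zero_iff (Nat.succ_ne_zero _),
    Finset.sum_eq_zero_iff_of_nonneg fun i _ => sub_nonneg.2 (cosCoord_le_one i _),
    proj_eq_zero_iff]
  refine forall_congr' fun i => ?_
  simp only [Finset.mem_univ, true_imp_iff]
  rw [cosCoord_proj, sub_eq_zero, eq_comm, Real.cos_eq_one_iff]
  refine exists_congr fun n => ?_
  rw [mul_comm, mul_right_inj' Real.two_pi_pos.ne']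

/-- From `1 - cos θ ≤ θ² / 2` each summand is at most `2π² ε²`; weakening `ε²` to `ε` still gives
the required order after taking the power. -/
lemma flatFun_proj_le {ε : ℝ} (h0 : 0 ≤ ε) (h1 : ε ≤ 1) {y : 𝔼} (hy : ∀ i, |y i| ≤ ε) :
    flatFun (proj y) ≤ (Fintype.card ι * (2 * Real.pi ^ 2)) ^ (Fintype.card ι + 1) *
      ε ^ (Fintype.card ι + 1) := by
  rw [← mul_pow]
  refine pow_le_pow_left₀ (Finset.sum_nonneg fun i _ => sub_nonneg.2 (cosCoord_le_one i _)) ?_ _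
  have h : ∀ i, 1 - cosCoord i (proj y) ≤ 2 * Real.pi ^ 2 * ε := by
    intro i
    rw [cosCoord_proj]
    have h2 := Real.one_sub_sq_div_two_le_cos (x := 2 * Real.pi * y i)
    have h3 : y i ^ 2 ≤ ε := by
      rw [← sq_abs]
      calc |y i| ^ 2 ≤ ε ^ 2 := by gcongr; exact hy i
        _ ≤ ε := by nlinarith
    nlinarith [mul_le_mul_of_nonneg_left h3 (by positivity : 0 ≤ 2 * Real.pi ^ 2)]
  calc ∑ i, (1 - cosCoord i (proj y))
      ≤ ∑ _ : ι, 2 * Real.pi ^ 2 * ε := Finset.sum_le_sum fun i _ => h i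
    _ = Fintype.card ι * (2 * Real.pi ^ 2) * ε := by
      rw [Finset.sum_const, Finset.card_univ, nsmul_eq_mul, ← mul_assoc]

/-- The slowing factors obtained from polynomials in a trigonometric function with values in
`[1, 3]`. -/
def polyFun (i : ι) : ℝ[X] →ₗ[ℝ] smoothFunctions ι where
  toFun p := ⟨fun x => flatFun x * p.eval (2 - cosCoord i x), by
    rw [mem_smoothFunctions]
    simp only [flatFun, cosCoord_proj]
    have hy : ∀ j, ContDiff ℝ ∞ fun y : 𝔼 => y j := fun j =>
      (EuclideanSpace.proj (𝕜 := ℝ) j).contDiff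
    have hcos : ∀ j, ContDiff ℝ ∞ fun y : 𝔼 => Real.cos (2 * Real.pi * y j) := fun j =>
      Real.contDiff_cos.comp (contDiff_const.mul (hy j))
    refine ((ContDiff.sum fun j _ => contDiff_const.sub (hcos j)).pow _).mul ?_
    have hp : ContDiff ℝ ∞ fun t : ℝ => p.eval t := by
      simpa only [coe_aeval_eq_eval] using p.contDiff_aeval (𝕜 := ℝ) ∞
    exact hp.comp (contDiff_const.sub (hcos i))⟩
  map_add' p q := by
    ext x
    simp [mul_add]
  map_smul' c p := by
    ext x
    simp [mul_left_comm]

lemma polyFun_apply (i : ι) (p : ℝ[X]) (x : UnitAddTorus ι) :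
    (polyFun i p).1 x = flatFun x * p.eval (2 - cosCoord i x) := rfl

lemma polyFun_injective (i : ι) : Function.Injective (polyFun i) := by
  classical
  rw [injective_iff_map_eq_zero]
  intro p hp
  refine Polynomial.eq_zero_of_infinite_isRoot p
    ((Ioo_infinite (show (1 : ℝ) < 3 by norm_num)).mono ?_)
  intro t ht
  -- This makes the cosine equal to `2 - t`. As `t > 1`, the point is not the origin, so `flatFun`
  -- is nonzero there and `t` is a root of `p`.
  set s := Real.arccos (2 - t) / (2 * Real.pi)
  set x : UnitAddTorus ι := proj (EuclideanSpace.single i s)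
  have hx : cosCoord i x = 2 - t := by
    rw [cosCoord_proj]
    simp only [PiLp.single_apply, if_true, s]
    rw [mul_div_cancel₀ _ Real.two_pi_pos.ne', Real.cos_arccos (by linarith [ht.2])
      (by linarith [ht.1])]
  have h1 : flatFun x * p.eval (2 - cosCoord i x) = 0 := by
    rw [← polyFun_apply, hp]; rfl
  rw [hx, sub_sub_cancel] at h1
  refine (mul_eq_zero.1 h1).resolve_left fun h => ?_
  rw [flatFun_eq_zero_iff] at h
  have h2 : cosCoord i x = 1 := by
    rw [h, ← proj_zero, cosCoord_proj]; simp
  linarith [ht.1]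

lemma isFlatAtZero_polyFun (i : ι) {p : ℝ[X]} (hp : ∀ t ∈ Icc (1 : ℝ) 3, 0 < p.eval t) :
    IsFlatAtZero (polyFun i p).1 := by
  have hmem : ∀ x : UnitAddTorus ι, 2 - cosCoord i x ∈ Icc (1 : ℝ) 3 := fun x =>
    ⟨by linarith [cosCoord_le_one i x], by linarith [neg_one_le_cosCoord i x]⟩
  obtain ⟨B, hB⟩ := (isCompact_Icc (a := (1 : ℝ)) (b := 3)).exists_bound_of_continuousOn
    p.continuous.continuousOn
  refine ⟨(polyFun i p).2, fun x => mul_nonneg (flatFun_nonneg x) (hp _ (hmem x)).le, fun x => ?_,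
    (Fintype.card ι * (2 * Real.pi ^ 2)) ^ (Fintype.card ι + 1) * B, fun ε h0 h1 y hy => ?_⟩
  · rw [polyFun_apply, mul_eq_zero, or_iff_left (hp _ (hmem x)).ne', flatFun_eq_zero_iff]
  · rw [polyFun_apply, mul_right_comm]
    exact mul_le_mul (flatFun_proj_le h0.le h1 hy) ((le_abs_self _).trans (hB _ (hmem _)))
      (hp _ (hmem _)).le (by positivity)

/-- The vector field on the torus associated with a polynomial. -/
def polyField (v : 𝔼) (r : ℕ∞) (i : ι) : ℝ[X] →ₗ[ℝ] VectorFields 𝔼 (UnitAddTorus ι) r :=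
  field v r ∘ₗ polyFun i

lemma polyField_injective {v : 𝔼} (hv : v ≠ 0) (r : ℕ∞) (i : ι) :
    Function.Injective (polyField v r i) :=
  (field_injective hv r).comp (polyFun_injective i)

lemma polyField_mem (v : 𝔼) (r : ℕ∞) (i : ι) {p : ℝ[X]}
    (hp : ∀ t ∈ Icc (1 : ℝ) 3, 0 < p.eval t) : polyField v r i p ∈ slowedFields v r :=
  ⟨_, isFlatAtZero_polyFun i hp, rfl⟩

lemma isConnected_slowedFields [Nonempty ι] (v : 𝔼) (r : ℕ∞) : IsConnected (slowedFields v r) :=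
  ⟨⟨_, polyField_mem v r (Classical.arbitrary ι) (p := 1) (by simp)⟩,
    isPreconnected_slowedFields v r⟩

/-- Monomials are positive on `[1, 3]`, so the span contains an injective linear image of all of
`ℝ[X]`. -/
lemma not_finiteDimensional_span_slowedFields [Nonempty ι] {v : 𝔼} (hv : v ≠ 0) (r : ℕ∞) :
    ¬ FiniteDimensional ℝ (Submodule.span ℝ (slowedFields v r)) := by
  intro h
  have i : ι := Classical.arbitrary ι
  have hmem : ∀ p, polyField v r i p ∈ Submodule.span ℝ (slowedFields v r) := by
    intro p
    induction p using Polynomial.induction_on' with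
    | add p q hp hq => rw [map_add]; exact add_mem hp hq
    | monomial n a =>
      rw [← smul_X_eq_monomial, map_smul]
      refine Submodule.smul_mem _ _ (Submodule.subset_span (polyField_mem v r i fun t ht => ?_))
      rw [eval_pow, eval_X]
      exact pow_pos (by linarith [ht.1]) n
  have hinj : Function.Injective ((polyField v r i).codRestrict _ hmem) := fun p q hpq =>
    polyField_injective hv r i (congrArg Subtype.val hpq)
  have := Module.Finite.of_injective _ hinj
  exact Polynomial.not_finite this

lemma exists_cube_subset_slowedFields [Nonempty ι] {v : 𝔼} (hv : v ≠ 0) (r : ℕ∞) (n : ℕ) :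
    ∃ S ⊆ slowedFields v r, Nonempty (S ≃ₜ (Fin n → unitInterval)) := by
  have i : ι := Classical.arbitrary ι
  -- The constant coefficient `1` keeps the polynomial positive on `[1, 3]` even when all cube
  -- parameters vanish.
  let b : (Fin n → unitInterval) → Fin (n + 1) → ℝ := fun c => Fin.cons 1 fun j => (c j : ℝ)
  let P : (Fin n → unitInterval) → ℝ[X] := fun c => ∑ j, b c j • X ^ (j : ℕ)
  have hb : Continuous b := by
    refine continuous_pi fun j => ?_
    refine Fin.cases ?_ (fun j => ?_) j
    · exact continuous_const
    · simp only [b, Fin.cons_succ]; fun_prop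
  have hcont : Continuous fun c => polyField v r i (P c) := by
    have h := (continuous_field_sum v r fun j : Fin (n + 1) => polyFun i (X ^ (j : ℕ))).comp hb
    refine h.congr fun c => ?_
    simp [P, polyField]
  have hcoeff : ∀ c j, (P c).coeff (Fin.val j) = b c j := by
    intro c j
    simp only [P, finsetSum_coeff, coeff_smul, coeff_X_pow, smul_eq_mul, mul_ite, mul_one,
      mul_zero, Fin.val_inj, Finset.sum_ite_eq, Finset.mem_univ, if_true]
  have hinj : Function.Injective fun c => polyField v r i (P c) := by
    intro c d hcd
    have h := polyField_injective hv r i hcd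
    funext j
    have h1 : b c j.succ = b d j.succ := by rw [← hcoeff, h, hcoeff]
    exact Subtype.ext h1
  refine ⟨range fun c => polyField v r i (P c), ?_,
    ⟨(hcont.isClosedEmbedding hinj).isEmbedding.toHomeomorph.symm⟩⟩
  rintro _ ⟨c, rfl⟩
  refine polyField_mem v r i fun t ht => ?_
  simp only [P, eval_finsetSum]
  simp only [eval_smul, eval_pow, eval_X, Fin.sum_univ_succ, b, Fin.cons_zero, Fin.cons_succ,
    smul_eq_mul]
  have : 0 ≤ ∑ j : Fin n, (c j : ℝ) * t ^ (j.succ : ℕ) :=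
    Finset.sum_nonneg fun j _ => mul_nonneg (c j).2.1 (pow_nonneg (by linarith [ht.1]) _)
  simp only [Fin.val_zero, pow_zero]
  linarith

/-- For consecutive powers of a transcendental number, an integer resonance is a polynomial
relation, hence trivial. -/
lemma exists_isNonresonant (n : ℕ) : ∃ v : EuclideanSpace ℝ (Fin n), IsNonresonant v := by
  have hθ : Transcendental ℤ (liouvilleNumber 2) := transcendental_liouvilleNumber le_rfl
  refine ⟨WithLp.toLp 2 fun i => liouvilleNumber 2 ^ (i : ℕ), fun k hk h => hk ?_⟩
  have h0 : (∑ i : Fin n, C (k i) * X ^ (i : ℕ) : ℤ[X]) = 0 := by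
    by_contra hne
    refine hθ ⟨_, hne, ?_⟩
    simpa [map_sum] using h
  funext i
  have h1 := congrArg (fun p => p.coeff (i : ℕ)) h0
  simpa [finsetSum_coeff, coeff_X_pow, Fin.val_inj] using h1

end UnitAddTorus

end

end

theorem theorem1p1 :
    ∃ (M : Type) (_ : TopologicalSpace M) (_ : ChartedSpace (EuclideanSpace ℝ (Fin 5)) M)
      (_ : IsManifold 𝓘(ℝ, EuclideanSpace ℝ (Fin 5)) ∞ M) (_ : CompactSpace M) (_ : T2Space M)
      (_ : MeasurableSpace M) (_ : BorelSpace M),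
      ∀ r : ℕ∞, 1 ≤ r →
        ∃ A : Set (ChaosTriviality.VectorFields (EuclideanSpace ℝ (Fin 5)) M r),
          A ⊆ ChaosTriviality.chaoticTrivialFields (EuclideanSpace ℝ (Fin 5)) M r ∧
          IsConnected A ∧
          ChaosTriviality.IsInfiniteDimensional A := by
  obtain ⟨v, hv⟩ := UnitAddTorus.exists_isNonresonant 5
  have hv0 : v ≠ 0 := by
    rintro rfl
    exact hv.apply_ne_zero 0 rfl
  refine ⟨UnitAddTorus (Fin 5), inferInstance, inferInstance, inferInstance, inferInstance,
    inferInstance, inferInstance, inferInstance, fun r _ => ?_⟩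
  refine ⟨UnitAddTorus.slowedFields v r, ?_, UnitAddTorus.isConnected_slowedFields v r,
    UnitAddTorus.not_finiteDimensional_span_slowedFields hv0 r,
    UnitAddTorus.exists_cube_subset_slowedFields hv0 r⟩
  rintro _ ⟨f, hf, rfl⟩
  exact UnitAddTorus.IsFlatAtZero.field_mem hv r hf
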